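/- Let $n\ge 1$, let $p$ be a complex polynomial of degree $n$ with zeros $z_1,\dots,z_n\in\mathbb{C}$ listed with multiplicity, and let $w_1,\dots,w_{n-1}\in\mathbb{C}$ be its critical points, i.e. the zeros of the derivative $p'$, listed with multiplicity. Assume that $\sum_{j=1}^n z_j=0$. Then $$\sum_{k=1}^{n-1}|w_k|^6\le \frac{n-6}{n}\sum_{j=1}^n|z_j|^6+\frac{6}{n^2}\left(\sum_{j=1}^n|z_j|^4\right)\left(\sum_{j=1}^n|z_j|^2\right)+\frac{3}{n^2}\left|\sum_{j=1}^n z_j|z_j|^2\right|^2-\frac{2}{n^3}\left(\sum_{j=1}^n|z_j|^2\right)^3,$$ and equality holds if and only if all the $z_j$ lie on one straight line in the complex plane. -/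

import Mathlib

open Polynomial

/-! ### Two matrix tools: a trace expansion and a diagonal inequality -/

namespace Matrix

/-! Compress `diagonal z` to the sum-zero vectors: `A = P D P`, with `P` the `centering` projection.
The eigenvalues of `A` are the critical points together with one extra 0
(`charpoly_centering_diagonal`). Triangularise `A` unitarily to `T`. Its diagonal carries these
eigenvalues, and |T_jj|⁶ ≤ ((T*T)_jj)³ ≤ ((T*T)³)_jj. Summing over j bounds ∑|w_k|⁶ by tr (A*A)³,
which is exactly the right-hand side (`trace_centering_diagonal`). Equality forces `T` to be
diagonal, so `A` is normal. Its commutator with A* then shows that every conj(z_i) z_j is real,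
which for centroid 0 is collinearity. Conversely, on a line through 0, `A` is a unimodular multiple
of A*, so `T` is also lower triangular. -/

theorem trace_add_vecMulVec_pow_three {m R : Type*} [Fintype m] [DecidableEq m] [CommRing R]
    (M : Matrix m m R) (u v : m → R) :
    ((M + vecMulVec u v) ^ 3).trace = (M ^ 3).trace + 3 * (v ⬝ᵥ (M *ᵥ (M *ᵥ u)))
      + 3 * ((v ⬝ᵥ (M *ᵥ u)) * (v ⬝ᵥ u)) + (v ⬝ᵥ u) ^ 3 := by
  have h1 (X Y : Matrix m m R) : (X * vecMulVec u v * Y).trace = v ⬝ᵥ ((Y * X) *ᵥ u) := by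
    rw [trace_mul_comm, ← mul_assoc, mul_vecMulVec, trace_vecMulVec, dotProduct_comm]
  have h2 (X : Matrix m m R) :
      vecMulVec u v * X * vecMulVec u v = (v ⬝ᵥ (X *ᵥ u)) • vecMulVec u v := by
    rw [mul_assoc, mul_vecMulVec, vecMulVec_mul_vecMulVec]
    ext i j
    simp [vecMulVec_apply]
    ring
  have h3 : vecMulVec u v * vecMulVec u v = (v ⬝ᵥ u) • vecMulVec u v := by
    simpa using h2 1
  have e : (M + vecMulVec u v) ^ 3 = M ^ 3 + (M * M * vecMulVec u v * 1
      + M * vecMulVec u v * M + 1 * vecMulVec u v * (M * M))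
      + (M * (vecMulVec u v * vecMulVec u v) + vecMulVec u v * M * vecMulVec u v
        + (vecMulVec u v * vecMulVec u v) * M)
      + vecMulVec u v * vecMulVec u v * vecMulVec u v := by noncomm_ring
  rw [e, h2, h3]
  simp only [trace_add, h1]
  simp only [mul_smul_comm, smul_mul_assoc, h3, trace_smul, trace_mul_comm _ M, mul_vecMulVec,
    trace_vecMulVec, smul_eq_mul, ← mulVec_mulVec, one_mul, mul_one, dotProduct_comm u,
    dotProduct_comm _ v]
  ring

open scoped ComplexOrder in
-- Matrix form of the tangent-line bound t³ ≥ 3h²t − 2h³ for t ≥ 0: the difference factors as (t −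
-- h)²(t + 2h). Reading the j-th diagonal entry with h = H_jj gives the claim.
theorem PosSemidef.diag_pow_three_le {m : Type*} [Fintype m] [DecidableEq m]
    {H : Matrix m m ℂ} (hH : H.PosSemidef) (j : m) : (H j j).re ^ 3 ≤ ((H ^ 3) j j).re := by
  have h0 : 0 ≤ H j j := hH.diag_nonneg
  set h : ℝ := (H j j).re with hh
  have hr : H j j = h := by
    apply Complex.ext <;> simp [hh, (Complex.nonneg_iff.1 h0).2.symm]
  have hpos : 0 ≤ h := (Complex.nonneg_iff.1 h0).1
  have h1 : (H + (2 * h : ℂ) • (1 : Matrix m m ℂ)).PosSemidef :=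
    hH.add (PosSemidef.one.smul (by exact_mod_cast (by positivity : (0 : ℝ) ≤ 2 * h)))
  have hG : (H - (h : ℂ) • (1 : Matrix m m ℂ))ᴴ = H - (h : ℂ) • (1 : Matrix m m ℂ) := by
    simp [conjTranspose_sub, conjTranspose_smul, hH.1.eq]
  have h2 := h1.conjTranspose_mul_mul_same (H - (h : ℂ) • (1 : Matrix m m ℂ))
  rw [hG] at h2
  have h3 := (Complex.nonneg_iff.1 (h2.diag_nonneg (i := j))).1
  have e : (H - (h : ℂ) • (1 : Matrix m m ℂ)) * (H + (2 * h : ℂ) • (1 : Matrix m m ℂ)) *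
      (H - (h : ℂ) • (1 : Matrix m m ℂ)) = H ^ 3 - (3 * h ^ 2 : ℂ) • H + (2 * h ^ 3 : ℂ) • 1 := by
    simp only [sub_mul, mul_sub, add_mul, mul_add, smul_mul_assoc, mul_smul_comm,
      one_mul, mul_one, pow_succ, pow_zero]
    module
  rw [e] at h3
  simp only [add_apply, sub_apply, smul_apply, one_apply_eq, hr, smul_eq_mul, mul_one] at h3
  have : (2 * (h : ℂ) ^ 3 - 3 * h ^ 2 * h) = ((- h ^ 3 : ℝ) : ℂ) := by push_cast; ring
  have e2 : (H ^ 3) j j - 3 * (h : ℂ) ^ 2 * h + 2 * (h : ℂ) ^ 3 =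
      (H ^ 3) j j + ((- h ^ 3 : ℝ) : ℂ) := by
    rw [← this]; ring
  rw [e2, Complex.add_re, Complex.ofReal_re] at h3
  linarith

end Matrix

/-! ### Schur triangularisation -/

theorem exists_orthonormal_triangular {E : Type*} [NormedAddCommGroup E] [InnerProductSpace ℂ E]
    [FiniteDimensional ℂ E] (n : ℕ) (hn : Module.finrank ℂ E = n) (T : E →ₗ[ℂ] E) :
    ∃ b : Fin n → E, Orthonormal ℂ b ∧ ∀ i j, j < i → inner ℂ (b i) (T (b j)) = 0 := by
  induction n generalizing E with
  | zero => exact ⟨Fin.elim0, by constructor <;> intro i <;> exact i.elim0, fun i => i.elim0⟩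
  | succ n ih =>
    have : Nontrivial E := Module.nontrivial_of_finrank_pos (R := ℂ) (by omega)
    -- An eigenvector of the adjoint has a `T`-invariant orthogonal complement; placed last in the
    -- basis, it leaves only zeros to the left of the diagonal in its row.
    obtain ⟨μ, hμ⟩ := Module.End.exists_eigenvalue (LinearMap.adjoint T)
    obtain ⟨v, hv⟩ := hμ.exists_hasEigenvector
    let F := (ℂ ∙ v)ᗮ
    have : Fact (Module.finrank ℂ E = n + 1) := ⟨hn⟩
    have hF : Module.finrank ℂ F = n := Submodule.finrank_orthogonal_span_singleton hv.2
    have hinv : ∀ x ∈ F, T x ∈ F := by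
      intro x hx
      rw [Submodule.mem_orthogonal_singleton_iff_inner_right] at hx ⊢
      rw [← LinearMap.adjoint_inner_left, hv.apply_eq_smul, inner_smul_left, hx, mul_zero]
    obtain ⟨b, hb, ht⟩ := ih hF (T.restrict hinv)
    have hFv (x : F) : inner ℂ v (x : E) = 0 :=
      (Submodule.mem_orthogonal_singleton_iff_inner_right).1 x.2
    have hFv' (x : F) : inner ℂ (x : E) v = 0 := by
      rw [← inner_conj_symm, hFv, map_zero]
    have hvn : (‖v‖ : ℂ) ≠ 0 := by simpa using hv.2
    refine ⟨Fin.snoc (fun i => (b i : E)) ((‖v‖⁻¹ : ℂ) • v), ?_, ?_⟩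
    · rw [orthonormal_iff_ite] at hb ⊢
      intro i j
      refine Fin.lastCases ?_ (fun i => ?_) i <;> refine Fin.lastCases ?_ (fun j => ?_) j
      · have h1 : ‖(‖v‖⁻¹ : ℂ) • v‖ = 1 := by
          simpa using norm_smul_inv_norm (𝕜 := ℂ) hv.2
        rw [inner_self_eq_norm_sq_to_K, Fin.snoc_last, h1]; simp
      · simp [inner_smul_left, hFv, (Fin.castSucc_ne_last j).symm]
      · simp [inner_smul_right, hFv', Fin.castSucc_ne_last]
      · simpa using hb i j
    · intro i j
      refine Fin.lastCases ?_ (fun i => ?_) i <;> refine Fin.lastCases ?_ (fun j => ?_) j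
      · simp
      · intro _
        have := hFv (T.restrict hinv (b j))
        simp only [LinearMap.coe_restrict_apply] at this
        simp [this]
      · intro h; exact absurd h (by simp [Fin.le_last])
      · intro h
        simpa using ht i j (by simpa using h)

namespace Matrix

theorem exists_unitary_triangular {n : ℕ} (A : Matrix (Fin n) (Fin n) ℂ) :
    ∃ U T : Matrix (Fin n) (Fin n) ℂ, Uᴴ * U = 1 ∧ U * Uᴴ = 1 ∧ T = Uᴴ * A * U ∧
      T.IsUpperTriangular := by
  obtain ⟨b, hb, ht⟩ := exists_orthonormal_triangular n (by simp)
    (Matrix.toEuclideanLin A)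
  let U : Matrix (Fin n) (Fin n) ℂ := of fun i j => b j i
  have hU : Uᴴ * U = 1 := by
    ext i j
    have := (orthonormal_iff_ite.1 hb) i j
    rw [one_apply, ← this]
    simp [mul_apply, U, PiLp.inner_apply, mul_comm]
  refine ⟨U, Uᴴ * A * U, hU, mul_eq_one_comm.1 hU, rfl, fun i j hij => ?_⟩
  rw [← ht i j hij, mul_assoc]
  simp only [mul_apply, U, PiLp.inner_apply, RCLike.inner_apply]
  simp [mulVec, dotProduct, mul_comm]

end Matrix

/-! ### Diagonal entries against the trace of (T*T)³ -/

namespace Matrix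

theorem conjTranspose_mul_self_apply_self {m : Type*} [Fintype m] (T : Matrix m m ℂ) (j : m) :
    (Tᴴ * T) j j = ((∑ i, ‖T i j‖ ^ 2 : ℝ) : ℂ) := by
  simp [mul_apply, Complex.conj_mul']

theorem norm_diag_pow_six_le {m : Type*} [Fintype m] [DecidableEq m] (T : Matrix m m ℂ) (j : m) :
    ‖T j j‖ ^ 6 ≤ (∑ i, ‖T i j‖ ^ 2) ^ 3 := by
  calc ‖T j j‖ ^ 6 = (‖T j j‖ ^ 2) ^ 3 := by ring
    _ ≤ _ := by
      gcongr
      exact Finset.single_le_sum (f := fun i => ‖T i j‖ ^ 2) (fun i _ => by positivity)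
        (Finset.mem_univ j)

open scoped ComplexOrder in
theorem sum_norm_sq_pow_three_le {m : Type*} [Fintype m] [DecidableEq m] (T : Matrix m m ℂ)
    (j : m) : (∑ i, ‖T i j‖ ^ 2) ^ 3 ≤ (((Tᴴ * T) ^ 3) j j).re := by
  simpa only [conjTranspose_mul_self_apply_self, Complex.ofReal_re] using
    (posSemidef_conjTranspose_mul_self T).diag_pow_three_le j

theorem sum_norm_diag_pow_six_le {m : Type*} [Fintype m] [DecidableEq m] (T : Matrix m m ℂ) :
    ∑ j, ‖T j j‖ ^ 6 ≤ (((Tᴴ * T) ^ 3).trace).re := by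
  rw [trace, Complex.re_sum]
  exact Finset.sum_le_sum fun j _ =>
    (norm_diag_pow_six_le T j).trans (sum_norm_sq_pow_three_le T j)

theorem sum_norm_diag_pow_six_eq_iff {m : Type*} [Fintype m] [DecidableEq m] (T : Matrix m m ℂ) :
    ∑ j, ‖T j j‖ ^ 6 = (((Tᴴ * T) ^ 3).trace).re ↔ T.IsDiag := by
  constructor
  · intro h
    rw [trace, Complex.re_sum] at h
    have h := (Finset.sum_eq_sum_iff_of_le fun j _ =>
      (norm_diag_pow_six_le T j).trans (sum_norm_sq_pow_three_le T j)).1 h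
    intro i j hij
    -- Equality of the sums is equality for each j, so each column norm comes from the diagonal
    -- entry alone.
    have h1 : (∑ i, ‖T i j‖ ^ 2) ^ 3 = (‖T j j‖ ^ 2) ^ 3 := by
      rw [← pow_mul]
      exact le_antisymm ((sum_norm_sq_pow_three_le T j).trans (h j (Finset.mem_univ j)).ge)
        (norm_diag_pow_six_le T j)
    have h2 := (pow_left_inj₀ (by positivity) (by positivity) three_ne_zero).1 h1
    rw [← Finset.sum_erase_add _ _ (Finset.mem_univ j), add_eq_right,
      Finset.sum_eq_zero_iff_of_nonneg fun i _ => by positivity] at h2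
    simpa using h2 i (by simpa using hij)
  · intro h
    obtain ⟨d, rfl⟩ : ∃ d, T = diagonal d := ⟨_, h.diagonal_diag.symm⟩
    simp only [diagonal_conjTranspose, diagonal_mul_diagonal, diagonal_pow, trace_diagonal,
      Complex.re_sum, diagonal_apply_eq]
    refine Finset.sum_congr rfl fun j _ => ?_
    simp [Complex.conj_mul', ← pow_mul]
    norm_cast

/-- The orthogonal projection onto the vectors whose entries sum to zero. -/
noncomputable def centering (n : ℕ) : Matrix (Fin n) (Fin n) ℂ :=
  1 - vecMulVec (fun _ => (n : ℂ)⁻¹) 1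

/-! ### Spectrum and trace of the compressed diagonal matrix -/

theorem vecMulVec_mean_mul_self {n : ℕ} (hn : n ≠ 0) :
    (vecMulVec (fun _ => (n : ℂ)⁻¹) 1 : Matrix (Fin n) (Fin n) ℂ) *
      vecMulVec (fun _ => (n : ℂ)⁻¹) 1 = vecMulVec (fun _ => (n : ℂ)⁻¹) 1 := by
  ext i j
  simp [mul_apply, vecMulVec_apply, hn]

theorem centering_mul_self {n : ℕ} (hn : n ≠ 0) : centering n * centering n = centering n := by
  simp only [centering, sub_mul, mul_sub, one_mul, mul_one, vecMulVec_mean_mul_self hn]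
  simp

theorem conjTranspose_centering (n : ℕ) : (centering n)ᴴ = centering n := by
  ext i j
  simp [centering, one_apply, eq_comm]

/-- Cycling the factors replaces P D P by P D, a rank-one perturbation of `D`. Away from the z_j,
the matrix determinant lemma gives the factor n + ∑ z_j/(x − z_j) = x ∑ 1/(x − z_j), x times the
logarithmic derivative. -/
theorem charpoly_centering_diagonal {n : ℕ} (hn : n ≠ 0) (z : Fin n → ℂ) :
    C (n : ℂ) * (centering n * diagonal z * centering n).charpoly =
      X * derivative (∏ j, (X - C (z j))) := by
  have h1 : (centering n * diagonal z * centering n).charpoly =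
      (diagonal z - vecMulVec (fun _ => (n : ℂ)⁻¹) z).charpoly := by
    rw [charpoly_mul_comm, ← mul_assoc, centering_mul_self hn, centering, sub_mul, one_mul,
      vecMulVec_mul]
    congr 3
    ext j
    simp [vecMul_diagonal]
  rw [h1]
  refine eq_of_infinite_eval_eq _ _ ((Set.finite_range z).infinite_compl.mono fun x hx => ?_)
  have hx' (j : Fin n) : x - z j ≠ 0 := fun h => hx ⟨j, (sub_eq_zero.1 h).symm⟩
  have h2 : scalar (Fin n) x - (diagonal z - vecMulVec (fun _ => (n : ℂ)⁻¹) z) =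
      diagonal (fun j => x - z j) *
        (1 + replicateCol Unit (fun j => (x - z j)⁻¹ * (n : ℂ)⁻¹) * replicateRow Unit z) := by
    rw [mul_add, ← vecMulVec_eq, mul_vecMulVec, mul_one]
    have : diagonal (fun j => x - z j) *ᵥ (fun j => (x - z j)⁻¹ * (n : ℂ)⁻¹) =
        fun _ => (n : ℂ)⁻¹ := by
      ext j
      simp [mulVec_diagonal, hx']
    rw [this, ← diagonal_sub]
    simp only [scalar_apply]
    abel
  have hn' : (n : ℂ) ≠ 0 := by exact_mod_cast hn
  have h3 : (n : ℂ) * (1 + z ⬝ᵥ fun j => (x - z j)⁻¹ * (n : ℂ)⁻¹) = x * ∑ j, (x - z j)⁻¹ := by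
    have : (n : ℂ) = ∑ j : Fin n, (x - z j) * (x - z j)⁻¹ := by simp [hx']
    rw [mul_add, mul_one, dotProduct, Finset.mul_sum]
    nth_rewrite 1 [this]
    rw [← Finset.sum_add_distrib, Finset.mul_sum]
    refine Finset.sum_congr rfl fun j _ => ?_
    field_simp
    ring
  simp only [Set.mem_ofPred_eq, eval_mul, eval_C, eval_X, eval_charpoly, h2, det_mul, det_diagonal,
    det_one_add_replicateCol_mul_replicateRow]
  rw [mul_left_comm, h3, derivative_prod_finset, eval_finsetSum, mul_left_comm, Finset.mul_sum]
  congr 1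
  refine Finset.sum_congr rfl fun j _ => ?_
  rw [← Finset.prod_erase_mul _ _ (Finset.mem_univ j)]
  simp [eval_prod, hx']

theorem trace_centering_diagonal {n : ℕ} (hn : n ≠ 0) (z : Fin n → ℂ) (hz : ∑ j, z j = 0) :
    (((centering n * diagonal z * centering n)ᴴ *
        (centering n * diagonal z * centering n)) ^ 3).trace
      = ((((n : ℝ) - 6) / (n : ℝ) * ∑ j, ‖z j‖ ^ 6
        + 6 / (n : ℝ) ^ 2 * (∑ j, ‖z j‖ ^ 4) * (∑ j, ‖z j‖ ^ 2)
        + 3 / (n : ℝ) ^ 2 * ‖∑ j, z j * (‖z j‖ : ℂ) ^ 2‖ ^ 2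
        - 2 / (n : ℝ) ^ 3 * (∑ j, ‖z j‖ ^ 2) ^ 3 : ℝ) : ℂ) := by
  have hn' : (n : ℂ) ≠ 0 := by exact_mod_cast hn
  set P := centering n with hP
  have hPP : P * P = P := centering_mul_self hn
  let y : Fin n → ℂ := star z
  let a : Fin n → ℂ := fun j => y j * z j
  have hy : ∑ j, y j = 0 := by simpa [y] using congrArg star hz
  -- `N` is D* P D. Since ∑ z_j = 0, it sends the all-ones vector to `a`, so `N * P` is `diagonal a`
  -- with two successive rank-one perturbations, and the cubic trace expansion applies twice.
  let N : Matrix (Fin n) (Fin n) ℂ := diagonal a + vecMulVec (fun j => -(y j * (n : ℂ)⁻¹)) z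
  have hN : (diagonal z)ᴴ * P * diagonal z = N := by
    rw [hP, centering, mul_sub, mul_one, sub_mul, mul_vecMulVec, vecMulVec_mul]
    ext i j
    simp [N, a, y, diagonal_apply, vecMulVec_apply, mulVec_diagonal, vecMul_diagonal,
      sub_eq_add_neg]
  have hcyc : (((P * diagonal z * P)ᴴ * (P * diagonal z * P)) ^ 3).trace = ((N * P) ^ 3).trace := by
    have e : (P * diagonal z * P)ᴴ * (P * diagonal z * P) = P * N * P := by
      rw [← hN, conjTranspose_mul, conjTranspose_mul, hP, conjTranspose_centering, ← hP]
      simp only [mul_assoc]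
      rw [← mul_assoc P P, hPP]
    have e2 : (P * N * P) ^ 3 = P * (N * P) ^ 3 := by
      have h (Y : Matrix (Fin n) (Fin n) ℂ) : P * (P * Y) = P * Y := by rw [← mul_assoc, hPP]
      simp only [pow_succ, pow_zero, one_mul, mul_assoc, h]
    have e3 : (N * P) ^ 3 * P = (N * P) ^ 3 := by
      simp only [pow_succ, pow_zero, one_mul, mul_assoc, hPP]
    rw [e, e2, trace_mul_comm, e3]
  have hNx (x : Fin n → ℂ) : N *ᵥ x = fun j => a j * x j - y j * ((n : ℂ)⁻¹ * ∑ k, z k * x k) := by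
    ext j
    simp [N, add_mulVec, mulVec_diagonal, vecMulVec_mulVec, dotProduct]
    ring
  have hNP : N * P = N + vecMulVec (fun j => -((n : ℂ)⁻¹ * a j)) 1 := by
    rw [hP, centering, mul_sub, mul_one, mul_vecMulVec, hNx, sub_eq_add_neg, ← neg_vecMulVec]
    congr 2
    ext j
    simp [← Finset.sum_mul, hz, mul_comm]
  set s2 := ∑ j, a j with hs2
  set s4 := ∑ j, a j ^ 2 with hs4
  set s6 := ∑ j, a j ^ 3 with hs6
  set r := ∑ j, z j * a j with hr
  set r' := ∑ j, y j * a j with hr'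
  have t1 : (N ^ 3).trace =
      s6 - 3 * (n : ℂ)⁻¹ * s6 + 3 * (n : ℂ)⁻¹ ^ 2 * s4 * s2 - (n : ℂ)⁻¹ ^ 3 * s2 ^ 3 := by
    have d1 : z ⬝ᵥ (fun j => -(y j * (n : ℂ)⁻¹)) = - (n : ℂ)⁻¹ * s2 := by
      rw [dotProduct, hs2, Finset.mul_sum]
      exact Finset.sum_congr rfl fun j _ => by simp only [a]; ring
    have d2 : z ⬝ᵥ (diagonal a *ᵥ fun j => -(y j * (n : ℂ)⁻¹)) = - (n : ℂ)⁻¹ * s4 := by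
      rw [dotProduct, hs4, Finset.mul_sum]
      exact Finset.sum_congr rfl fun j _ => by simp only [a, mulVec_diagonal]; ring
    have d3 : z ⬝ᵥ (diagonal a *ᵥ (diagonal a *ᵥ fun j => -(y j * (n : ℂ)⁻¹))) =
        - (n : ℂ)⁻¹ * s6 := by
      rw [dotProduct, hs6, Finset.mul_sum]
      exact Finset.sum_congr rfl fun j _ => by simp only [a, mulVec_diagonal]; ring
    rw [trace_add_vecMulVec_pow_three, d1, d2, d3, diagonal_pow, trace_diagonal]
    simp only [Pi.pow_apply, ← hs6]
    ring
  have c1 : N *ᵥ (fun j => -((n : ℂ)⁻¹ * a j)) =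
      fun j => -(n : ℂ)⁻¹ * a j ^ 2 + (n : ℂ)⁻¹ ^ 2 * r * y j := by
    rw [hNx]
    have : ∑ k, z k * -((n : ℂ)⁻¹ * a k) = -(n : ℂ)⁻¹ * r := by
      rw [hr, Finset.mul_sum]
      exact Finset.sum_congr rfl fun j _ => by ring
    rw [this]
    ext j
    ring
  have d1 : (1 : Fin n → ℂ) ⬝ᵥ (fun j => -((n : ℂ)⁻¹ * a j)) = -(n : ℂ)⁻¹ * s2 := by
    simp [dotProduct, hs2, Finset.mul_sum]
  have d2 : (1 : Fin n → ℂ) ⬝ᵥ (N *ᵥ fun j => -((n : ℂ)⁻¹ * a j)) = -(n : ℂ)⁻¹ * s4 := by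
    rw [c1]
    simp [dotProduct, hs4, Finset.sum_add_distrib, ← Finset.mul_sum, hy]
  -- The product r r' here is the source of the term |∑ z_j |z_j|²|².
  have d3 : (1 : Fin n → ℂ) ⬝ᵥ (N *ᵥ (N *ᵥ fun j => -((n : ℂ)⁻¹ * a j))) =
      -(n : ℂ)⁻¹ * s6 + (n : ℂ)⁻¹ ^ 2 * r * r' := by
    rw [c1, hNx]
    simp only [dotProduct, Pi.one_apply, one_mul, Finset.sum_sub_distrib, ← Finset.sum_mul, hy,
      zero_mul, sub_zero]
    clear_value r
    rw [hs6, hr', Finset.mul_sum, Finset.mul_sum,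
      ← Finset.sum_add_distrib]
    exact Finset.sum_congr rfl fun j _ => by ring
  have ha (j : Fin n) : a j = (‖z j‖ : ℂ) ^ 2 := by simp [a, y, Complex.conj_mul']
  have hrr : r * r' = ((‖∑ j, z j * (‖z j‖ : ℂ) ^ 2‖ ^ 2 : ℝ) : ℂ) := by
    have h1 : r = ∑ j, z j * (‖z j‖ : ℂ) ^ 2 := by simp only [hr, ha]
    have h2 : r' = star r := by simp [hr', h1, ha, y]
    rw [← h1, h2]
    simp [Complex.mul_conj']
  rw [hcyc, hNP, trace_add_vecMulVec_pow_three, t1, d1, d2, d3]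
  have e2 : ((∑ j, ‖z j‖ ^ 2 : ℝ) : ℂ) = s2 := by simp [hs2, ha]
  have e4 : ((∑ j, ‖z j‖ ^ 4 : ℝ) : ℂ) = s4 := by simp [hs4, ha, ← pow_mul]
  have e6 : ((∑ j, ‖z j‖ ^ 6 : ℝ) : ℂ) = s6 := by simp [hs6, ha, ← pow_mul]
  rw [Complex.ofReal_sub, Complex.ofReal_add, Complex.ofReal_add, Complex.ofReal_mul,
    Complex.ofReal_mul, Complex.ofReal_mul, Complex.ofReal_mul, Complex.ofReal_mul, ← hrr, e2, e4,
    e6, Complex.ofReal_pow, e2]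
  push_cast
  field_simp
  ring

end Matrix

/-! ### The equality case -/

theorem collinear_range_iff_of_sum_eq_zero {n : ℕ} (hn : n ≠ 0) (z : Fin n → ℂ)
    (hz : ∑ j, z j = 0) :
    Collinear ℝ (Set.range z) ↔ ∀ i j, star (z i) * z j = z i * star (z j) := by
  constructor
  · intro h
    obtain ⟨p, v, h⟩ := (collinear_iff_exists_forall_eq_smul_vadd _).1 h
    choose t ht using fun j => h (z j) ⟨j, rfl⟩
    have hn' : (n : ℂ) ≠ 0 := by exact_mod_cast hn
    -- The centroid 0 lies on the line, so the line can be taken through the origin.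
    have hp : p = ((-(n : ℝ)⁻¹ * ∑ j, t j : ℝ) : ℂ) * v := by
      have : (n : ℂ) * p = - ((∑ j, t j : ℝ) : ℂ) * v := by
        simp only [ht, Finset.sum_add_distrib, vadd_eq_add, Complex.real_smul, ← Finset.sum_mul,
          Finset.sum_const, Finset.card_univ, Fintype.card_fin, nsmul_eq_mul] at hz
        push_cast
        linear_combination hz
      push_cast at this ⊢
      field_simp
      linear_combination this
    obtain ⟨c, hc⟩ : ∃ c : Fin n → ℝ, ∀ j, z j = c j * v :=
      ⟨fun j => t j + (-(n : ℝ)⁻¹ * ∑ j, t j), fun j => by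
        rw [ht j, hp, vadd_eq_add, Complex.real_smul]
        push_cast
        ring⟩
    intro i j
    simp only [hc, star_mul', RCLike.star_def, Complex.conj_ofReal]
    ring
  · intro h
    by_cases h0 : ∀ j, z j = 0
    · exact (collinear_singleton ℝ (0 : ℂ)).subset (by rintro _ ⟨j, rfl⟩; exact h0 j)
    push Not at h0
    obtain ⟨i, hi⟩ := h0
    refine (collinear_iff_exists_forall_eq_smul_vadd _).2 ⟨0, z i, ?_⟩
    rintro _ ⟨j, rfl⟩
    have hr : ((z j / z i).re : ℂ) = z j / z i := by
      rw [← Complex.conj_eq_iff_re, map_div₀, div_eq_div_iff (by simpa using hi) hi]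
      have := h i j
      simp only [RCLike.star_def] at this
      linear_combination -this
    exact ⟨(z j / z i).re, by rw [Complex.real_smul, hr]; simp [hi]⟩

namespace Matrix

theorem conjTranspose_centering_diagonal {n : ℕ} (z : Fin n → ℂ) :
    (centering n * diagonal z * centering n)ᴴ = centering n * diagonal (star z) * centering n := by
  simp [conjTranspose_mul, conjTranspose_centering, mul_assoc]

theorem star_mul_eq_of_centering_normal {n : ℕ} (hn : n ≠ 0) (z : Fin n → ℂ)
    (hz : ∑ j, z j = 0)
    (h : (centering n * diagonal z * centering n)ᴴ * (centering n * diagonal z * centering n) =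
      (centering n * diagonal z * centering n) * (centering n * diagonal z * centering n)ᴴ)
    (i j : Fin n) : star (z i) * z j = z i * star (z j) := by
  have hn' : (n : ℂ) ≠ 0 := by exact_mod_cast hn
  -- The first summand is symmetric in x and y, so in the commutator only the rank-one terms
  -- survive.
  have key (x y : Fin n → ℂ) (hx : ∑ j, x j = 0) (hy : ∑ j, y j = 0) :
      (centering n * diagonal x * centering n) * (centering n * diagonal y * centering n) =
      centering n * diagonal (x * y) * centering n - vecMulVec (fun j => x j * (n : ℂ)⁻¹) y := by
    have hPx : centering n *ᵥ (fun j => x j * (n : ℂ)⁻¹) = fun j => x j * (n : ℂ)⁻¹ := by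
      rw [centering, sub_mulVec, one_mulVec, vecMulVec_mulVec]
      ext j
      simp [dotProduct, ← Finset.sum_mul, hx]
    have hyP : y ᵥ* centering n = y := by
      rw [centering, vecMul_sub, vecMul_one, vecMul_vecMulVec]
      ext j
      simp [dotProduct, ← Finset.sum_mul, hy]
    have e : diagonal x * centering n * diagonal y =
        diagonal (x * y) - vecMulVec (fun j => x j * (n : ℂ)⁻¹) y := by
      rw [centering, mul_sub, mul_one, sub_mul, mul_vecMulVec, vecMulVec_mul]
      ext i j
      simp [diagonal_apply, vecMulVec_apply, mulVec_diagonal, vecMul_diagonal]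
    calc _ = centering n * (diagonal x * (centering n * centering n) * diagonal y) *
          centering n := by simp only [mul_assoc]
      _ = _ := by
        rw [centering_mul_self hn, e, mul_sub, sub_mul, mul_vecMulVec, vecMulVec_mul, hPx, hyP]
  have hz' : ∑ j, (star z) j = 0 := by simpa using congrArg star hz
  rw [conjTranspose_centering_diagonal, key _ _ hz' hz, key _ _ hz hz', mul_comm z,
    sub_right_inj] at h
  have := congrFun (congrFun h i) j
  simp only [vecMulVec_apply, Pi.star_apply] at this
  field_simp at this
  exact this

theorem star_smul_centering_eq {n : ℕ} (z : Fin n → ℂ)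
    (h : ∀ i j, star (z i) * z j = z i * star (z j)) (i : Fin n) :
    star (z i) • (centering n * diagonal z * centering n) =
      z i • (centering n * diagonal z * centering n)ᴴ := by
  have : star (z i) • diagonal z = z i • diagonal (star z) := by
    rw [← diagonal_smul, ← diagonal_smul]
    congr 1
    ext j
    exact h i j
  rw [conjTranspose_centering_diagonal, ← smul_mul_assoc, ← mul_smul_comm, this, mul_smul_comm,
    smul_mul_assoc]

theorem isDiag_of_star_smul_eq {m : Type*} [LinearOrder m] {T : Matrix m m ℂ}
    (hT : T.IsUpperTriangular) {c : ℂ} (hc : c ≠ 0) (h : star c • T = c • Tᴴ) : T.IsDiag := by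
  intro i j hij
  rcases hij.lt_or_gt with hlt | hlt
  · have := congrFun (congrFun h i) j
    simpa [hT hlt, hc] using this
  · exact hT hlt

end Matrix

/-! ### Assembly -/

open Matrix in
theorem theorem2p1 (n : ℕ) (hn : 1 ≤ n) (p : ℂ[X]) (hp : p.natDegree = n)
    (z : Fin n → ℂ) (hz : p.roots = Finset.univ.val.map z)
    (w : Fin (n - 1) → ℂ) (hw : (derivative p).roots = Finset.univ.val.map w)
    (hsum : ∑ j, z j = 0) :
    (∑ k, ‖w k‖ ^ 6 ≤
      ((n : ℝ) - 6) / (n : ℝ) * ∑ j, ‖z j‖ ^ 6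
        + 6 / (n : ℝ) ^ 2 * (∑ j, ‖z j‖ ^ 4) * (∑ j, ‖z j‖ ^ 2)
        + 3 / (n : ℝ) ^ 2 * ‖∑ j, z j * (‖z j‖ : ℂ) ^ 2‖ ^ 2
        - 2 / (n : ℝ) ^ 3 * (∑ j, ‖z j‖ ^ 2) ^ 3) ∧
    (∑ k, ‖w k‖ ^ 6 =
      ((n : ℝ) - 6) / (n : ℝ) * ∑ j, ‖z j‖ ^ 6
        + 6 / (n : ℝ) ^ 2 * (∑ j, ‖z j‖ ^ 4) * (∑ j, ‖z j‖ ^ 2)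
        + 3 / (n : ℝ) ^ 2 * ‖∑ j, z j * (‖z j‖ : ℂ) ^ 2‖ ^ 2
        - 2 / (n : ℝ) ^ 3 * (∑ j, ‖z j‖ ^ 2) ^ 3 ↔
      Collinear ℝ (Set.range z)) := by
  have hn0 : n ≠ 0 := by omega
  set A := centering n * diagonal z * centering n with hA
  obtain ⟨U, T, hU, hU', hT, htri⟩ := exists_unitary_triangular A
  have hAT : A = U * T * Uᴴ := by
    rw [hT]
    calc A = (U * Uᴴ) * A * (U * Uᴴ) := by simp [hU']
      _ = _ := by simp only [mul_assoc]
  have cancel (Y : Matrix (Fin n) (Fin n) ℂ) : Uᴴ * (U * Y) = Y := by rw [← mul_assoc, hU, one_mul]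
  have hAA : Aᴴ * A = U * (Tᴴ * T) * Uᴴ := by
    rw [hAT]
    simp only [conjTranspose_mul, conjTranspose_conjTranspose, mul_assoc, cancel]
  have htrace : ((Aᴴ * A) ^ 3).trace = ((Tᴴ * T) ^ 3).trace := by
    have : (Aᴴ * A) ^ 3 = U * (Tᴴ * T) ^ 3 * Uᴴ := by
      rw [hAA]
      simp only [pow_succ, pow_zero, one_mul, mul_assoc, cancel]
    rw [this, trace_mul_comm, cancel]
  -- The extra 0 is the root of the factor `X`; it adds nothing to the sum of sixth powers.
  have hroots : Finset.univ.val.map (fun j => T j j) = 0 ::ₘ Finset.univ.val.map w := by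
    have hp0 : p ≠ 0 := by rintro rfl; simp at hp; omega
    have hprod : p = C p.leadingCoeff * ∏ j, (X - C (z j)) := by
      conv_lhs => rw [(IsAlgClosed.splits p).eq_prod_roots, hz, Multiset.map_map]
      rfl
    have hw' : (derivative (∏ j, (X - C (z j)))).roots = Finset.univ.val.map w := by
      rw [← hw]
      conv_rhs => rw [hprod, derivative_C_mul, roots_C_mul _ (leadingCoeff_ne_zero.2 hp0)]
    have hch : T.charpoly = A.charpoly := by
      rw [hAT, charpoly_mul_comm, cancel]
    have h1 := charpoly_centering_diagonal hn0 z
    rw [← hA, ← hch] at h1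
    have hne : C (n : ℂ) * T.charpoly ≠ 0 :=
      mul_ne_zero (by simpa using hn0) (charpoly_monic T).ne_zero
    have h2 := congrArg roots h1
    rw [roots_C_mul _ (by exact_mod_cast hn0), roots_mul (h1 ▸ hne), roots_X, hw',
      charpoly_of_isUpperTriangular _ htri, roots_prod _ _ (by
        rw [← charpoly_of_isUpperTriangular _ htri]; exact (charpoly_monic T).ne_zero)] at h2
    simpa [Multiset.bind_singleton] using h2
  have hsix : ∑ k, ‖w k‖ ^ 6 = ∑ j, ‖T j j‖ ^ 6 := by
    have := congrArg (fun s => (s.map fun x : ℂ => ‖x‖ ^ 6).sum) hroots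
    simpa [Multiset.map_map, Finset.sum, Function.comp_def] using this.symm
  have hre := congrArg Complex.re (trace_centering_diagonal hn0 z hsum)
  rw [← hA, htrace, Complex.ofReal_re] at hre
  rw [hsix, ← hre]
  refine ⟨sum_norm_diag_pow_six_le T, (sum_norm_diag_pow_six_eq_iff T).trans ?_⟩
  rw [collinear_range_iff_of_sum_eq_zero hn0 z hsum]
  constructor
  · intro hd
    apply star_mul_eq_of_centering_normal hn0 z hsum
    have hTT : Tᴴ * T = T * Tᴴ := by
      rw [← hd.diagonal_diag, diagonal_conjTranspose, diagonal_mul_diagonal, diagonal_mul_diagonal]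
      simp only [mul_comm]
    rw [← hA, hAA, hTT, hAT]
    simp only [conjTranspose_mul, conjTranspose_conjTranspose, mul_assoc, cancel]
  · intro h
    by_cases h0 : ∃ i, z i ≠ 0
    · obtain ⟨i, hi⟩ := h0
      refine isDiag_of_star_smul_eq htri hi ?_
      have := star_smul_centering_eq z h i
      rw [← hA] at this
      calc star (z i) • T = Uᴴ * (star (z i) • A) * U := by
            rw [hT, mul_smul_comm, smul_mul_assoc]
        _ = z i • Tᴴ := by
            rw [this, mul_smul_comm, smul_mul_assoc, hT]
            simp only [conjTranspose_mul, conjTranspose_conjTranspose, mul_assoc]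
    · push Not at h0
      have : z = 0 := funext h0
      intro i j _
      simp [hT, hA, this]
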